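/- **Language.** Fix a set of atoms. *Formulae* are $A ::= p \mid \top \mid \bot \mid A\to A \mid A -\!\!\!< A \mid A\wedge A \mid A\vee A \mid \square A \mid \lozenge A \mid \blacksquare A \mid \blacklozenge A$, with $p$ an atom. An *IKt-formula* is a formula without exclusion $-\!\!\!<$; an *IK-formula* is an IKt-formula without $\blacksquare,\blacklozenge$. *Structures* are $X ::= \emptyset \mid A \mid (X,X) \mid X\triangleright X \mid \circ X \mid \bullet X$, taken modulo associativity and commutativity of the comma with unit $\emptyset$ (at any depth); $\circ,\bullet$ bind tighter than the comma, which binds tighter than $\triangleright$. A *nested sequent* is a structure $X\triangleright Y$. **The calculus LBiKtE.** We write $S_1;\dots;S_n \,/\, S$ for the rule with premises $S_1,\dots,S_n$ and conclusion $S$. All of the following hold for arbitrary structures and formulae ($i\in\{1,2\}$). - Axioms: $X,A\triangleright A,Y$; $\ X,\bot\triangleright Y$; $\ X\triangleright\top,Y$. - Weakening and contraction: $X\triangleright Z \,/\, X,Y\triangleright Z$; $\ X\triangleright Z\,/\,X\triangleright Y,Z$; $\ X,Y,Y\triangleright Z\,/\,X,Y\triangleright Z$; $\ X\triangleright Y,Y,Z\,/\,X\triangleright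 Y,Z$. - Residuation: $(X_1\triangleright Y_1),X_2\triangleright Y_2\,/\,X_1,X_2\triangleright Y_1,Y_2$; $\ X_1\triangleright Y_1,(X_2\triangleright Y_2)\,/\,X_1,X_2\triangleright Y_1,Y_2$; $\ X_2\triangleright Y_2,Y_1\,/\,(X_2\triangleright Y_2)\triangleright Y_1$; $\ X_1,X_2\triangleright Y_2\,/\,X_1\triangleright(X_2\triangleright Y_2)$; and, in both directions, $\bullet X\triangleright Y\,/\,X\triangleright\circ Y$ and $\circ X\triangleright Y\,/\,X\triangleright\bullet Y$. - Cut: $X_1\triangleright Y_1,A;\ A,X_2\triangleright Y_2\,/\,X_1,X_2\triangleright Y_1,Y_2$. - Propositional rules: $X,B_i\triangleright Y\,/\,X,B_1\wedge B_2\triangleright Y$; $\ X\triangleright A,Y;\ X\triangleright B,Y\,/\,X\triangleright A\wedge B,Y$; $\ X,A\triangleright Y;\ X,B\triangleright Y\,/\,X,A\vee B\triangleright Y$; $\ X\triangleright B_i,Y\,/\,X\triangleright B_1\vee B_2,Y$; $\ X\triangleright A,Y;\ X,B\triangleright Y\,/\,X,A\to B\triangleright Y$; $\ X,A\triangleright B\,/\,X\triangleright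 A\to B,Y$; $\ A\triangleright B,Y\,/\,X,A-\!\!\!<B\triangleright Y$; $\ X\triangleright A,Y;\ X,B\triangleright Y\,/\,X\triangleright A-\!\!\!<B,Y$. - Modal rules: $A\triangleright X\,/\,\square A\triangleright\circ X$; $\ X\triangleright\circ A\,/\,X\triangleright\square A$; $\ A\triangleright X\,/\,\blacksquare A\triangleright\bullet X$; $\ X\triangleright\bullet A\,/\,X\triangleright\blacksquare A$; $\ \circ A\triangleright X\,/\,\lozenge A\triangleright X$; $\ X\triangleright A\,/\,\circ X\triangleright\lozenge A$; $\ \bullet A\triangleright X\,/\,\blacklozenge A\triangleright X$; $\ X\triangleright A\,/\,\bullet X\triangleright\blacklozenge A$. - Two further structural rules: $X\triangleright(\bullet Y\triangleright\bullet Z)\,/\,X\triangleright\bullet(Y\triangleright Z)$ and $X\triangleright(\circ Y\triangleright\circ Z)\,/\,X\triangleright\circ(Y\triangleright Z)$. **Semantics.** A *Kripke model* is $\langle W,\le,R_\lozenge,R_\square,V\rangle$ with $W\neq\emptyset$, $\le$ reflexive and transitive on $W$, binary relations $R_\lozenge,R_\square$ on $W$ such that (F1) $x\le y$ and $xR_\lozenge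 z$ imply $yR_\lozenge w$ and $z\le w$ for some $w$; (F2) $xR_\square y$ and $y\le z$ imply $x\le w$ and $wR_\square z$ for some $w$; and a valuation $V$ assigning to each atom a $\le$-upward closed subset of $W$. Satisfaction: $w\Vdash p$ iff $w\in V(p)$; $\top,\bot,\wedge,\vee$ are as usual; $w\Vdash A\to B$ iff every $v\ge w$ with $v\Vdash A$ has $v\Vdash B$; $w\Vdash A-\!\!\!<B$ iff some $v\le w$ has $v\Vdash A$ and $v\not\Vdash B$; $w\Vdash\lozenge A$ iff $\exists v\,(wR_\lozenge v$ and $v\Vdash A)$; $w\Vdash\square A$ iff $v\Vdash A$ whenever $w\le z$ and $zR_\square v$; $w\Vdash\blacklozenge A$ iff $\exists v\,(vR_\square w$ and $v\Vdash A)$; $w\Vdash\blacksquare A$ iff $v\Vdash A$ whenever $w\le z$ and $vR_\lozenge z$. An *E-model* is a Kripke model with $R_\lozenge=R_\square$. An IKt-formula is *IKt-valid* if it is satisfied at every world of every E-model. An IK-formula is *IK-valid* if it is satisfied at every world of every birelational model $\langle W,\le,R,V\rangle$, where $W\neq\emptyset$, $\le$ is reflexive and transitive, the one relation $R$ satisfies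 (F1) and (F2), $V$ is persistent as above, and both $\lozenge$ and $\square$ are interpreted by the clauses above with $R$ in place of $R_\lozenge$ and $R_\square$. **Theorem (Conservativity over IKt and IK).** (1) For every IKt-formula $A$: $A$ is IKt-valid if and only if $\emptyset\triangleright A$ is derivable in LBiKtE. (2) For every IK-formula $A$: $A$ is IK-valid if and only if $\emptyset\triangleright A$ is derivable in LBiKtE. -/

import Mathlib

universe u

namespace BiKt

/-! ### Formulae and structures -/

/-- Formulae of bi-intuitionistic tense logic over a set of atoms.
`excl A B` is exclusion (the connective dual to implication); `box`, `dia` are the white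
modalities and `bbox`, `bdia` are the black ones. -/
inductive Formula (Atom : Type u) : Type u
  | atom (p : Atom)
  | top
  | bot
  | imp (A B : Formula Atom)
  | excl (A B : Formula Atom)
  | and (A B : Formula Atom)
  | or (A B : Formula Atom)
  | box (A : Formula Atom)
  | dia (A : Formula Atom)
  | bbox (A : Formula Atom)
  | bdia (A : Formula Atom)

/-- Structures: the empty structure, formulae, `(X, Y)`, `X ▷ Y`, `∘X` and `•X`. -/
inductive Structure (Atom : Type u) : Type u
  | empty
  | form (A : Formula Atom)
  | comma (X Y : Structure Atom)
  | seq (X Y : Structure Atom)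
  | white (X : Structure Atom)
  | black (X : Structure Atom)

/-- Structural comma. -/
infixl:65 " ⨟ " => Structure.comma

/-- The structural connective `▷`, as a constructor of structures. -/
infixr:60 " ▷ " => Structure.seq

/-- Structural circle. -/
prefix:75 "∘." => Structure.white

/-- Structural bullet. -/
prefix:75 "•." => Structure.black

/-- A formula seen as a structure. -/
prefix:80 "↟" => Structure.form

/-- Equality of structures modulo associativity and commutativity of the structural comma
and its unit `empty`: the least congruence containing these three laws. -/
inductive Structure.Equiv {Atom : Type u} : Structure Atom → Structure Atom → Prop
  | refl (X : Structure Atom) : Equiv X X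
  | symm {X Y : Structure Atom} : Equiv X Y → Equiv Y X
  | trans {X Y Z : Structure Atom} : Equiv X Y → Equiv Y Z → Equiv X Z
  | assoc (X Y Z : Structure Atom) : Equiv ((X ⨟ Y) ⨟ Z) (X ⨟ (Y ⨟ Z))
  | comm (X Y : Structure Atom) : Equiv (X ⨟ Y) (Y ⨟ X)
  | unit (X : Structure Atom) : Equiv (X ⨟ .empty) X
  | comma {X X' Y Y' : Structure Atom} : Equiv X X' → Equiv Y Y' → Equiv (X ⨟ Y) (X' ⨟ Y')
  | seq {X X' Y Y' : Structure Atom} : Equiv X X' → Equiv Y Y' → Equiv (X ▷ Y) (X' ▷ Y')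
  | white {X X' : Structure Atom} : Equiv X X' → Equiv (∘.X) (∘.X')
  | black {X X' : Structure Atom} : Equiv X X' → Equiv (•.X) (•.X')

/-! ### The shallow nested sequent calculus -/

/-- `LBiKtE X Y` says that the nested sequent `X ▷ Y` is derivable in the calculus LBiKtE,
that is, in LBiKt (all the rules up to `bdiaR`, cut included) extended with the two structural
rules `blackSeqR` and `whiteSeqR`.  The rule `equiv` expresses that structures are taken modulo
`Structure.Equiv`.  The invertible rules of residuation are given by their two directions. -/
inductive LBiKtE {Atom : Type u} : Structure Atom → Structure Atom → Prop
  | equiv {X X' Y Y' : Structure Atom} :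
      X.Equiv X' → Y.Equiv Y' → LBiKtE X Y → LBiKtE X' Y'
  -- identity and logical constants
  | id (X Y : Structure Atom) (A : Formula Atom) : LBiKtE (X ⨟ ↟A) (↟A ⨟ Y)
  | botL (X Y : Structure Atom) : LBiKtE (X ⨟ ↟.bot) Y
  | topR (X Y : Structure Atom) : LBiKtE X (↟.top ⨟ Y)
  -- structural rules
  | wL {X Z : Structure Atom} (Y : Structure Atom) : LBiKtE X Z → LBiKtE (X ⨟ Y) Z
  | wR {X Z : Structure Atom} (Y : Structure Atom) : LBiKtE X Z → LBiKtE X (Y ⨟ Z)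
  | cL {X Y Z : Structure Atom} : LBiKtE (X ⨟ Y ⨟ Y) Z → LBiKtE (X ⨟ Y) Z
  | cR {X Y Z : Structure Atom} : LBiKtE X (Y ⨟ Y ⨟ Z) → LBiKtE X (Y ⨟ Z)
  | sL {X₁ Y₁ X₂ Y₂ : Structure Atom} :
      LBiKtE ((X₁ ▷ Y₁) ⨟ X₂) Y₂ → LBiKtE (X₁ ⨟ X₂) (Y₁ ⨟ Y₂)
  | sR {X₁ Y₁ X₂ Y₂ : Structure Atom} :
      LBiKtE X₁ (Y₁ ⨟ (X₂ ▷ Y₂)) → LBiKtE (X₁ ⨟ X₂) (Y₁ ⨟ Y₂)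
  | seqL {X₂ Y₂ Y₁ : Structure Atom} : LBiKtE X₂ (Y₂ ⨟ Y₁) → LBiKtE (X₂ ▷ Y₂) Y₁
  | seqR {X₁ X₂ Y₂ : Structure Atom} : LBiKtE (X₁ ⨟ X₂) Y₂ → LBiKtE X₁ (X₂ ▷ Y₂)
  | rpWhite {X Y : Structure Atom} : LBiKtE (•.X) Y → LBiKtE X (∘.Y)
  | rpWhiteInv {X Y : Structure Atom} : LBiKtE X (∘.Y) → LBiKtE (•.X) Y
  | rpBlack {X Y : Structure Atom} : LBiKtE (∘.X) Y → LBiKtE X (•.Y)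
  | rpBlackInv {X Y : Structure Atom} : LBiKtE X (•.Y) → LBiKtE (∘.X) Y
  | cut {X₁ Y₁ X₂ Y₂ : Structure Atom} {A : Formula Atom} :
      LBiKtE X₁ (Y₁ ⨟ ↟A) → LBiKtE (↟A ⨟ X₂) Y₂ → LBiKtE (X₁ ⨟ X₂) (Y₁ ⨟ Y₂)
  -- logical rules
  | andL₁ {X Y : Structure Atom} {A : Formula Atom} (B : Formula Atom) :
      LBiKtE (X ⨟ ↟A) Y → LBiKtE (X ⨟ ↟(.and A B)) Y
  | andL₂ {X Y : Structure Atom} (A : Formula Atom) {B : Formula Atom} :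
      LBiKtE (X ⨟ ↟B) Y → LBiKtE (X ⨟ ↟(.and A B)) Y
  | andR {X Y : Structure Atom} {A B : Formula Atom} :
      LBiKtE X (↟A ⨟ Y) → LBiKtE X (↟B ⨟ Y) → LBiKtE X (↟(.and A B) ⨟ Y)
  | orL {X Y : Structure Atom} {A B : Formula Atom} :
      LBiKtE (X ⨟ ↟A) Y → LBiKtE (X ⨟ ↟B) Y → LBiKtE (X ⨟ ↟(.or A B)) Y
  | orR₁ {X Y : Structure Atom} {A : Formula Atom} (B : Formula Atom) :
      LBiKtE X (↟A ⨟ Y) → LBiKtE X (↟(.or A B) ⨟ Y)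
  | orR₂ {X Y : Structure Atom} (A : Formula Atom) {B : Formula Atom} :
      LBiKtE X (↟B ⨟ Y) → LBiKtE X (↟(.or A B) ⨟ Y)
  | impL {X Y : Structure Atom} {A B : Formula Atom} :
      LBiKtE X (↟A ⨟ Y) → LBiKtE (X ⨟ ↟B) Y → LBiKtE (X ⨟ ↟(.imp A B)) Y
  | impR {X : Structure Atom} (Y : Structure Atom) {A B : Formula Atom} :
      LBiKtE (X ⨟ ↟A) (↟B) → LBiKtE X (↟(.imp A B) ⨟ Y)
  | exclL (X : Structure Atom) {Y : Structure Atom} {A B : Formula Atom} :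
      LBiKtE (↟A) (↟B ⨟ Y) → LBiKtE (X ⨟ ↟(.excl A B)) Y
  | exclR {X Y : Structure Atom} {A B : Formula Atom} :
      LBiKtE X (↟A ⨟ Y) → LBiKtE (X ⨟ ↟B) Y → LBiKtE X (↟(.excl A B) ⨟ Y)
  | boxL {X : Structure Atom} {A : Formula Atom} : LBiKtE (↟A) X → LBiKtE (↟(.box A)) (∘.X)
  | boxR {X : Structure Atom} {A : Formula Atom} : LBiKtE X (∘.↟A) → LBiKtE X (↟(.box A))
  | bboxL {X : Structure Atom} {A : Formula Atom} : LBiKtE (↟A) X → LBiKtE (↟(.bbox A)) (•.X)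
  | bboxR {X : Structure Atom} {A : Formula Atom} : LBiKtE X (•.↟A) → LBiKtE X (↟(.bbox A))
  | diaL {X : Structure Atom} {A : Formula Atom} : LBiKtE (∘.↟A) X → LBiKtE (↟(.dia A)) X
  | diaR {X : Structure Atom} {A : Formula Atom} : LBiKtE X (↟A) → LBiKtE (∘.X) (↟(.dia A))
  | bdiaL {X : Structure Atom} {A : Formula Atom} : LBiKtE (•.↟A) X → LBiKtE (↟(.bdia A)) X
  | bdiaR {X : Structure Atom} {A : Formula Atom} : LBiKtE X (↟A) → LBiKtE (•.X) (↟(.bdia A))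
  -- the two additional structural rules
  | blackSeqR {X Y Z : Structure Atom} : LBiKtE X (•.Y ▷ •.Z) → LBiKtE X (•.(Y ▷ Z))
  | whiteSeqR {X Y Z : Structure Atom} : LBiKtE X (∘.Y ▷ ∘.Z) → LBiKtE X (∘.(Y ▷ Z))

/-! ### Kripke semantics -/

/-- Kripke frames for bi-intuitionistic tense logic. -/
structure KripkeFrame where
  World : Type u
  nonempty : Nonempty World
  le : World → World → Prop
  le_refl : ∀ x, le x x
  le_trans : ∀ x y z, le x y → le y z → le x z
  Rdia : World → World → Prop
  Rbox : World → World → Prop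
  F1 : ∀ x y z, le x y → Rdia x z → ∃ w, Rdia y w ∧ le z w
  F2 : ∀ x y z, Rbox x y → le y z → ∃ w, le x w ∧ Rbox w z

/-- Kripke models: a frame with a persistent valuation. -/
structure KripkeModel (Atom : Type u) extends KripkeFrame.{u} where
  val : Atom → Set World
  persistent : ∀ p w v, le w v → w ∈ val p → v ∈ val p

/-- Satisfaction of a formula at a world of a Kripke model. -/
def KripkeModel.Sat {Atom : Type u} (M : KripkeModel Atom) : M.World → Formula Atom → Prop
  | w, .atom p => w ∈ M.val p
  | _, .top => True
  | _, .bot => False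
  | w, .imp A B => ∀ v, M.le w v → M.Sat v A → M.Sat v B
  | w, .excl A B => ∃ v, M.le v w ∧ M.Sat v A ∧ ¬ M.Sat v B
  | w, .and A B => M.Sat w A ∧ M.Sat w B
  | w, .or A B => M.Sat w A ∨ M.Sat w B
  | w, .box A => ∀ z v, M.le w z → M.Rbox z v → M.Sat v A
  | w, .dia A => ∃ v, M.Rdia w v ∧ M.Sat v A
  | w, .bbox A => ∀ z v, M.le w z → M.Rdia v z → M.Sat v A
  | w, .bdia A => ∃ v, M.Rbox v w ∧ M.Sat v A

/-- E-frames: the two accessibility relations coincide. -/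
def KripkeFrame.IsEFrame (F : KripkeFrame.{u}) : Prop := F.Rbox = F.Rdia

/-- E-validity: truth at all worlds of every model over an E-frame.  (Worlds range over the
universe of the atoms.) -/
def EValid {Atom : Type u} (A : Formula Atom) : Prop :=
  ∀ M : KripkeModel Atom, M.IsEFrame → ∀ w, M.Sat w A

/-! ### Intuitionistic tense logic IKt -/

/-- IKt-formulae: the exclusion-free formulae. -/
def IsIKtFormula {Atom : Type u} : Formula Atom → Prop
  | .atom _ => True
  | .top => True
  | .bot => True
  | .imp A B => IsIKtFormula A ∧ IsIKtFormula B
  | .excl _ _ => False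
  | .and A B => IsIKtFormula A ∧ IsIKtFormula B
  | .or A B => IsIKtFormula A ∧ IsIKtFormula B
  | .box A => IsIKtFormula A
  | .dia A => IsIKtFormula A
  | .bbox A => IsIKtFormula A
  | .bdia A => IsIKtFormula A

/-- IKt-validity is E-validity (of IKt-formulae). -/
def IKtValid {Atom : Type u} (A : Formula Atom) : Prop := EValid A

/-! ### Intuitionistic modal logic IK -/

/-- IK-formulae: intuitionistic connectives and the white modalities only. -/
inductive IKFormula (Atom : Type u) : Type u
  | atom (p : Atom)
  | top
  | bot
  | imp (A B : IKFormula Atom)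
  | and (A B : IKFormula Atom)
  | or (A B : IKFormula Atom)
  | box (A : IKFormula Atom)
  | dia (A : IKFormula Atom)

/-- IK-formulae as formulae of bi-intuitionistic tense logic. -/
def IKFormula.toFormula {Atom : Type u} : IKFormula Atom → Formula Atom
  | .atom p => .atom p
  | .top => .top
  | .bot => .bot
  | .imp A B => .imp A.toFormula B.toFormula
  | .and A B => .and A.toFormula B.toFormula
  | .or A B => .or A.toFormula B.toFormula
  | .box A => .box A.toFormula
  | .dia A => .dia A.toFormula

/-- Birelational models of IK: a preordered set of worlds with one accessibility relation `R`
satisfying the two confluence conditions, and a persistent valuation. -/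
structure IKModel (Atom : Type u) where
  World : Type u
  nonempty : Nonempty World
  le : World → World → Prop
  le_refl : ∀ x, le x x
  le_trans : ∀ x y z, le x y → le y z → le x z
  R : World → World → Prop
  F1 : ∀ x y z, le x y → R x z → ∃ w, R y w ∧ le z w
  F2 : ∀ x y z, R x y → le y z → ∃ w, le x w ∧ R w z
  val : Atom → Set World
  persistent : ∀ p w v, le w v → w ∈ val p → v ∈ val p

/-- Satisfaction of an IK-formula at a world of a birelational model. -/
def IKModel.Sat {Atom : Type u} (M : IKModel Atom) : M.World → IKFormula Atom → Prop
  | w, .atom p => w ∈ M.val p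
  | _, .top => True
  | _, .bot => False
  | w, .imp A B => ∀ v, M.le w v → M.Sat v A → M.Sat v B
  | w, .and A B => M.Sat w A ∧ M.Sat w B
  | w, .or A B => M.Sat w A ∨ M.Sat w B
  | w, .box A => ∀ z v, M.le w z → M.R z v → M.Sat v A
  | w, .dia A => ∃ v, M.R w v ∧ M.Sat v A

/-- IK-validity: truth at all worlds of every birelational model. -/
def IKValid {Atom : Type u} (A : IKFormula Atom) : Prop :=
  ∀ M : IKModel Atom, ∀ w, M.Sat w A

end BiKt

namespace BiKt

universe v

/-! ### Soundness over E-models -/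

namespace KripkeModel

variable {Atom : Type u}

/-! Soundness reads a structure as a formula according to its side: `▷` is exclusion on the left and
implication on the right, while `∘` and `•` are the diamonds `◇`, `◆` on the left and the boxes `□`,
`■` on the right. Every rule then preserves truth at all worlds of an E-model (`LBiKtE.sound`);
equality of the two relations matters only for `blackSeqR` and `whiteSeqR`.

Completeness is algebraic and uses cut freely. Formulae modulo interderivability form a Heyting
algebra with adjunctions `◇ ⊣ ■` and `◆ ⊣ □`, and the two extra structural rules become the laws
`(◆a ⇨ ■b) ≤ ■(a ⇨ b)` and `(◇a ⇨ □b) ≤ □(a ⇨ b)`. Over any such algebra the prime filters, ordered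
by inclusion, carry a single relation `Rel` that serves both pairs of modalities, so they form an
E-frame; the key existence lemma is `exists_rel`. The truth lemma `sat_canonicalModel_iff` then
refutes every underivable exclusion-free formula.

For IK, birelational models and E-models carry the same data, with the same satisfaction of
IK-formulae. -/

theorem sat_mono (M : KripkeModel Atom) (A : Formula Atom) :
    ∀ {w v : M.World}, M.le w v → M.Sat w A → M.Sat v A := by
  induction A with
  | atom p => exact fun h => M.persistent p _ _ h
  | top => exact fun _ _ => trivial
  | bot => exact fun _ h => h
  | imp A B => exact fun h hw u hu => hw u (M.le_trans _ _ _ h hu)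
  | excl A B => exact fun h ⟨u, hu, hAB⟩ => ⟨u, M.le_trans _ _ _ hu h, hAB⟩
  | and A B ihA ihB => exact fun h hw => ⟨ihA h hw.1, ihB h hw.2⟩
  | or A B ihA ihB => exact fun h hw => hw.imp (ihA h) (ihB h)
  | box A => exact fun h hw z u hz => hw z u (M.le_trans _ _ _ h hz)
  | dia A ih =>
    rintro w v h ⟨u, hu, hA⟩
    obtain ⟨u', hu', hle⟩ := M.F1 _ _ _ h hu
    exact ⟨u', hu', ih hle hA⟩
  | bbox A => exact fun h hw z u hz => hw z u (M.le_trans _ _ _ h hz)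
  | bdia A ih =>
    rintro w v h ⟨u, hu, hA⟩
    obtain ⟨u', hle, hu'⟩ := M.F2 _ _ _ hu h
    exact ⟨u', hu', ih hle hA⟩

end KripkeModel

/-- The formula expressing a structure: in antecedent position if the flag is `true`, in
succedent position otherwise. -/
def Structure.interp {Atom : Type u} : Structure Atom → Bool → Formula Atom
  | .empty, true => .top
  | .empty, false => .bot
  | .form A, _ => A
  | .comma X Y, true => .and (X.interp true) (Y.interp true)
  | .comma X Y, false => .or (X.interp false) (Y.interp false)
  | .seq X Y, true => .excl (X.interp true) (Y.interp false)
  | .seq X Y, false => .imp (X.interp true) (Y.interp false)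
  | .white X, true => .dia (X.interp true)
  | .white X, false => .box (X.interp false)
  | .black X, true => .bdia (X.interp true)
  | .black X, false => .bbox (X.interp false)

theorem Structure.Equiv.sat_interp {Atom : Type u} (M : KripkeModel Atom)
    {X Y : Structure Atom} (h : X.Equiv Y) :
    ∀ (b : Bool) (w : M.World), M.Sat w (X.interp b) ↔ M.Sat w (Y.interp b) := by
  induction h with
  | refl => exact fun _ _ => Iff.rfl
  | symm _ ih => exact fun b w => (ih b w).symm
  | trans _ _ ih₁ ih₂ => exact fun b w => (ih₁ b w).trans (ih₂ b w)
  | assoc =>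
    rintro (_ | _) w
    · exact or_assoc
    · exact and_assoc
  | comm =>
    rintro (_ | _) w
    · exact or_comm
    · exact and_comm
  | unit =>
    rintro (_ | _) w
    · exact or_iff_left id
    · exact and_iff_left trivial
  | comma _ _ ih₁ ih₂ =>
    rintro (_ | _) w
    · exact or_congr (ih₁ _ w) (ih₂ _ w)
    · exact and_congr (ih₁ _ w) (ih₂ _ w)
  | seq _ _ ih₁ ih₂ => rintro (_ | _) w <;> simp [Structure.interp, KripkeModel.Sat, ih₁, ih₂]
  | white _ ih => rintro (_ | _) w <;> simp [Structure.interp, KripkeModel.Sat, ih]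
  | black _ ih => rintro (_ | _) w <;> simp [Structure.interp, KripkeModel.Sat, ih]

theorem LBiKtE.sound {Atom : Type u} (M : KripkeModel Atom) (hM : M.IsEFrame)
    {X Y : Structure Atom} (h : LBiKtE X Y) :
    ∀ w, M.Sat w (X.interp true) → M.Sat w (Y.interp false) := by
  have hR : M.Rbox = M.Rdia := hM
  have mono := fun (A : Formula Atom) {w v} => M.sat_mono A (w := w) (v := v)
  have le_refl := M.le_refl
  induction h with
  | equiv hX hY _ ih =>
    exact fun w hw => (hY.sat_interp M _ w).1 (ih w ((hX.sat_interp M _ w).2 hw))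
  | id => exact fun w hw => .inl hw.2
  | botL => exact fun w hw => hw.2.elim
  | topR => exact fun w _ => .inl trivial
  | wL _ _ ih => exact fun w hw => ih w hw.1
  | wR _ _ ih => exact fun w hw => .inr (ih w hw)
  | cL _ ih => exact fun w hw => ih w ⟨hw, hw.2⟩
  | cR _ ih => exact fun w hw => (ih w hw).imp or_self_iff.1 _root_.id
  | sL _ ih =>
    -- Classical case split: if `Y₁` fails at `w`, then `w` itself witnesses the exclusion `X₁ ▷
    -- Y₁`.
    intro w hw
    by_contra hn
    exact hn (.inr (ih w ⟨⟨w, le_refl w, hw.1, fun h => hn (.inl h)⟩, hw.2⟩))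
  | sR _ ih => exact fun w hw => (ih w hw.1).imp _root_.id fun h => h w (le_refl w) hw.2
  | seqL _ ih =>
    rintro w ⟨v, hv, hX, hY⟩
    exact mono _ hv ((ih v hX).resolve_left hY)
  | seqR _ ih => exact fun w hw v hv hX => ih v ⟨mono _ hv hw, hX⟩
  | rpWhite _ ih => exact fun w hw z v hz hv => ih v ⟨z, hv, mono _ hz hw⟩
  | rpWhiteInv _ ih => exact fun w ⟨v, hv, hX⟩ => ih v hX v w (le_refl v) hv
  | rpBlack _ ih => exact fun w hw z v hz hv => ih v ⟨z, hv, mono _ hz hw⟩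
  | rpBlackInv _ ih => exact fun w ⟨v, hv, hX⟩ => ih v hX v w (le_refl v) hv
  | cut _ _ ih₁ ih₂ =>
    exact fun w hw => (ih₁ w hw.1).elim .inl fun hA => .inr (ih₂ w ⟨hA, hw.2⟩)
  | andL₁ _ _ ih => exact fun w hw => ih w ⟨hw.1, hw.2.1⟩
  | andL₂ _ _ ih => exact fun w hw => ih w ⟨hw.1, hw.2.2⟩
  | andR _ _ ih₁ ih₂ =>
    exact fun w hw => (ih₁ w hw).elim
      (fun hA => (ih₂ w hw).elim (fun hB => .inl ⟨hA, hB⟩) .inr) .inr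
  | orL _ _ ih₁ ih₂ =>
    exact fun w hw => hw.2.elim (fun h => ih₁ w ⟨hw.1, h⟩) (fun h => ih₂ w ⟨hw.1, h⟩)
  | orR₁ _ _ ih => exact fun w hw => (ih w hw).imp .inl _root_.id
  | orR₂ _ _ ih => exact fun w hw => (ih w hw).imp .inr _root_.id
  | impL _ _ ih₁ ih₂ =>
    exact fun w hw => (ih₁ w hw.1).elim
      (fun hA => ih₂ w ⟨hw.1, hw.2 w (le_refl w) hA⟩) _root_.id
  | impR _ _ ih => exact fun w hw => .inl fun v hv hA => ih v ⟨mono _ hv hw, hA⟩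
  | exclL _ _ ih =>
    rintro w ⟨-, v, hv, hA, hB⟩
    exact mono _ hv ((ih v hA).resolve_left hB)
  | @exclR X Y A B _ _ ih₁ ih₂ =>
    intro w hw
    refine (ih₁ w hw).elim (fun hA => ?_) .inr
    by_cases hB : M.Sat w B
    · exact .inr (ih₂ w ⟨hw, hB⟩)
    · exact .inl ⟨w, le_refl w, hA, hB⟩
  | boxL _ ih => exact fun w hw z v hz hv => ih v (hw z v hz hv)
  | boxR _ ih => exact ih
  | bboxL _ ih => exact fun w hw z v hz hv => ih v (hw z v hz hv)
  | bboxR _ ih => exact ih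
  | diaL _ ih => exact ih
  | diaR _ ih => exact fun w ⟨v, hv, hA⟩ => ⟨v, hv, ih v hA⟩
  | bdiaL _ ih => exact ih
  | bdiaR _ ih => exact fun w ⟨v, hv, hA⟩ => ⟨v, hv, ih v hA⟩
  | blackSeqR _ ih =>
    intro w hw z v hz hv v' hv' hY
    -- (F1) yields a successor `z'` of `v'` above `z`. As `R◇ = R□`, the world `v'` makes `◆Y` true
    -- at `z'`; the premise gives `■Z` there, hence `Z` back at `v'`.
    obtain ⟨z', hz', hle⟩ := M.F1 _ _ _ hv' hv
    exact ih w hw z' (M.le_trans _ _ _ hz hle) ⟨v', hR ▸ hz', hY⟩ z' v' (le_refl z') hz'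
  | whiteSeqR _ ih =>
    intro w hw z v hz hv v' hv' hY
    obtain ⟨z', hle, hz'⟩ := M.F2 _ _ _ hv hv'
    exact ih w hw z' (M.le_trans _ _ _ hz hle) ⟨v', hR ▸ hz', hY⟩ z' v' (le_refl z') hz'

/-! ### Heyting algebras with tense operators and their prime filter frames -/

/-- Two adjoint pairs of operators on a Heyting algebra, subject to the interaction laws of
intuitionistic tense logic. -/
structure TenseOperators (H : Type v) [HeytingAlgebra H] where
  box : H → H
  dia : H → H
  bbox : H → H
  bdia : H → H
  gc_dia_bbox : GaloisConnection dia bbox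
  gc_bdia_box : GaloisConnection bdia box
  bdia_himp_bbox_le (a b : H) : (bdia a ⇨ bbox b) ≤ bbox (a ⇨ b)
  dia_himp_box_le (a b : H) : (dia a ⇨ box b) ≤ box (a ⇨ b)

namespace TenseOperators

variable {H : Type v} [HeytingAlgebra H] (T : TenseOperators H)

/-- Exchange of the white and the black operators. -/
def swap : TenseOperators H where
  box := T.bbox
  dia := T.bdia
  bbox := T.box
  bdia := T.dia
  gc_dia_bbox := T.gc_bdia_box
  gc_bdia_box := T.gc_dia_bbox
  bdia_himp_bbox_le := T.dia_himp_box_le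
  dia_himp_box_le := T.bdia_himp_bbox_le

/-- Transposing along `◇ ⊣ ■`, the black interaction law at `□a`, `◇b` suffices, since `◆□a ≤ a` and
`b ≤ ■◇b`. This is the inequality that makes `exists_rel` work. -/
theorem dia_himp_inf_box_le (a b : H) : T.dia (a ⇨ b) ⊓ T.box a ≤ T.dia b := by
  rw [← le_himp_iff]
  apply T.gc_dia_bbox.l_le
  refine le_trans ?_ (T.bdia_himp_bbox_le _ _)
  exact himp_le_himp (T.gc_bdia_box.l_u_le a) (T.gc_dia_bbox.le_u_l b)

theorem box_top : T.box ⊤ = ⊤ := T.gc_bdia_box.u_top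

theorem box_inf (a b : H) : T.box (a ⊓ b) = T.box a ⊓ T.box b := T.gc_bdia_box.u_inf

theorem dia_bot : T.dia ⊥ = ⊥ := T.gc_dia_bbox.l_bot

theorem dia_sup (a b : H) : T.dia (a ⊔ b) = T.dia a ⊔ T.dia b := T.gc_dia_bbox.l_sup

/-- Accessibility between prime filters. -/
def Rel (F G : Order.PFilter H) : Prop :=
  (∀ a, T.box a ∈ F → a ∈ G) ∧ ∀ a, a ∈ G → T.dia a ∈ F

/-- The units and counits of the adjunctions make the black relation the converse of the white one.
Hence one relation interprets all four modalities, and each white result has a black counterpart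
through `swap`. -/
theorem rel_swap {F G : Order.PFilter H} : T.swap.Rel G F ↔ T.Rel F G := by
  constructor
  · rintro ⟨h₁, h₂⟩
    exact ⟨fun a ha => Order.PFilter.mem_of_le (T.gc_bdia_box.l_u_le a) (h₂ _ ha),
      fun a ha => h₁ _ (Order.PFilter.mem_of_le (T.gc_dia_bbox.le_u_l a) ha)⟩
  · rintro ⟨h₁, h₂⟩
    exact ⟨fun a ha => Order.PFilter.mem_of_le (T.gc_dia_bbox.l_u_le a) (h₂ _ ha),
      fun a ha => h₁ _ (Order.PFilter.mem_of_le (T.gc_bdia_box.le_u_l a) ha)⟩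

end TenseOperators

/-! ### Prime filters of a Heyting algebra -/

section PrimeFilters

variable {H : Type v} [HeytingAlgebra H]

theorem bot_notMem_of_isPrime {F : Order.PFilter H} (hF : F.IsPrime) : (⊥ : H) ∉ F :=
  Order.Ideal.bot_mem hF.compl_ideal.toIdeal

theorem sup_mem_iff_of_isPrime {F : Order.PFilter H} (hF : F.IsPrime) {a b : H} :
    a ⊔ b ∈ F ↔ a ∈ F ∨ b ∈ F := by
  refine ⟨fun h => ?_, fun h => h.elim (Order.PFilter.mem_of_le le_sup_left)
    (Order.PFilter.mem_of_le le_sup_right)⟩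
  by_contra! hn
  exact Order.Ideal.sup_mem (s := hF.compl_ideal.toIdeal) hn.1 hn.2 h

theorem exists_isPrime_of_disjoint {P : Order.PFilter H} {I : Order.Ideal H}
    (h : Disjoint (P : Set H) I) :
    ∃ F : Order.PFilter H, F.IsPrime ∧ P ≤ F ∧ ∀ a ∈ I, a ∉ F := by
  obtain ⟨J, hJ, hIJ, hPJ⟩ := DistribLattice.prime_ideal_of_disjoint_filter_ideal h
  refine ⟨hJ.toPrimePair.F, hJ.toPrimePair.F_isPrime, fun a ha haJ => ?_, fun a ha haF => ?_⟩
  · exact Set.disjoint_left.1 hPJ ha haJ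
  · exact haF (hIJ ha)

theorem exists_isPrime_of_notMem {P : Order.PFilter H} {b : H} (h : b ∉ P) :
    ∃ F : Order.PFilter H, F.IsPrime ∧ P ≤ F ∧ b ∉ F := by
  obtain ⟨F, hF, hPF, hb⟩ := exists_isPrime_of_disjoint (P := P) (I := .principal b)
    (Set.disjoint_left.2 fun a haP hab => h (Order.PFilter.mem_of_le hab haP))
  exact ⟨F, hF, hPF, hb b (Order.Ideal.mem_principal.2 le_rfl)⟩

/-- The filter `{x | a ⇨ x ∈ F}`, generated by `F` and `a`. -/
def adjoinFilter (F : Order.PFilter H) (a : H) : Order.PFilter H :=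
  Order.IsPFilter.toPFilter (F := {x | a ⇨ x ∈ F}) <| .of_def
    ⟨⊤, by simp⟩
    (fun x hx y hy => ⟨x ⊓ y, by
      change a ⇨ x ⊓ y ∈ F
      rw [himp_inf_distrib]
      exact Order.PFilter.inf_mem hx hy, inf_le_left, inf_le_right⟩)
    fun h hx => Order.PFilter.mem_of_le (himp_le_himp_left h) hx

theorem mem_adjoinFilter {F : Order.PFilter H} {a x : H} : x ∈ adjoinFilter F a ↔ a ⇨ x ∈ F :=
  Iff.rfl

/-- If `a ⇨ b ∉ F`, then `b` avoids the filter generated by `F` and `a`, which extends to a prime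
filter still avoiding `b`. -/
theorem himp_mem_iff {F : Order.PFilter H} {a b : H} :
    a ⇨ b ∈ F ↔ ∀ G : Order.PFilter H, G.IsPrime → F ≤ G → a ∈ G → b ∈ G := by
  constructor
  · intro h G _ hFG ha
    exact Order.PFilter.mem_of_le himp_inf_le (Order.PFilter.inf_mem (hFG h) ha)
  · intro h
    by_contra hn
    obtain ⟨G, hG, hFG, hb⟩ := exists_isPrime_of_notMem (mt mem_adjoinFilter.1 hn)
    refine hb (h G hG (fun x hx => hFG ?_) (hFG ?_))
    · exact mem_adjoinFilter.2 (Order.PFilter.mem_of_le le_himp hx)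
    · exact mem_adjoinFilter.2 (by simp)

end PrimeFilters

/-! ### Existence of accessible prime filters -/

namespace TenseOperators

variable {H : Type v} [HeytingAlgebra H] (T : TenseOperators H)

/-- The filter `{a | □a ∈ F}`. -/
def boxFilter (F : Order.PFilter H) : Order.PFilter H :=
  Order.IsPFilter.toPFilter (F := {a | T.box a ∈ F}) <| .of_def
    ⟨⊤, by simp [T.box_top]⟩
    (fun x hx y hy => ⟨x ⊓ y, by
      change T.box (x ⊓ y) ∈ F
      rw [box_inf]
      exact Order.PFilter.inf_mem hx hy, inf_le_left, inf_le_right⟩)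
    fun h hx => Order.PFilter.mem_of_le (T.gc_bdia_box.monotone_u h) hx

/-- The ideal `{a | ◇a ∉ F}` for a prime filter `F`. -/
def diaIdeal {F : Order.PFilter H} (hF : F.IsPrime) : Order.Ideal H :=
  Order.IsIdeal.toIdeal (I := {a | T.dia a ∉ F})
    ⟨fun _ _ h ha hb => ha (Order.PFilter.mem_of_le (T.gc_dia_bbox.monotone_l h) hb),
      ⟨⊥, by
        change T.dia ⊥ ∉ F
        rw [dia_bot]
        exact bot_notMem_of_isPrime hF⟩,
      fun x hx y hy => ⟨x ⊔ y, by
        change T.dia (x ⊔ y) ∉ F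
        rw [dia_sup, sup_mem_iff_of_isPrime hF]
        exact not_or.2 ⟨hx, hy⟩, le_sup_left, le_sup_right⟩⟩

/-- The filter generated by a filter `P` and by `{a | □a ∈ F}`. -/
def joinBoxFilter (F P : Order.PFilter H) : Order.PFilter H :=
  Order.IsPFilter.toPFilter (F := {x | ∃ a ∈ P, T.box (a ⇨ x) ∈ F}) <| .of_def
    ⟨⊤, ⊤, by simp, by simp [T.box_top]⟩
    (by
      rintro x ⟨a, ha, hx⟩ y ⟨b, hb, hy⟩
      refine ⟨x ⊓ y, ⟨a ⊓ b, Order.PFilter.inf_mem ha hb, ?_⟩, inf_le_left, inf_le_right⟩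
      refine Order.PFilter.mem_of_le ?_ (Order.PFilter.inf_mem hx hy)
      rw [← box_inf]
      apply T.gc_bdia_box.monotone_u
      rw [himp_inf_distrib]
      exact inf_le_inf (himp_le_himp_right inf_le_left) (himp_le_himp_right inf_le_right))
    fun h ⟨a, ha, hx⟩ =>
      ⟨a, ha, Order.PFilter.mem_of_le (T.gc_bdia_box.monotone_u (himp_le_himp_left h)) hx⟩

/-- A filter all of whose images under `◇` lie in a prime filter `F` extends to a prime filter
accessible from `F`. -/
theorem exists_rel {F : Order.PFilter H} (hF : F.IsPrime) (P : Order.PFilter H)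
    (hP : ∀ a ∈ P, T.dia a ∈ F) : ∃ G : Order.PFilter H, G.IsPrime ∧ P ≤ G ∧ T.Rel F G := by
  obtain ⟨G, hG, hPG, hd⟩ := exists_isPrime_of_disjoint (P := T.joinBoxFilter F P)
    (I := T.diaIdeal hF) <| Set.disjoint_left.2 <| by
      -- A common element `x` comes with `◇a` and `□(a ⇨ x)` in `F`. From `a ≤ (a ⇨ x) ⇨ x` and
      -- `dia_himp_inf_box_le` it follows that `◇x ∈ F`, contradicting `x ∈ diaIdeal`.
      rintro x ⟨a, ha, hx⟩ hd
      refine hd (Order.PFilter.mem_of_le ?_ (Order.PFilter.inf_mem (hP a ha) hx))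
      refine le_trans (inf_le_inf_right _ (T.gc_dia_bbox.monotone_l ?_))
        (T.dia_himp_inf_box_le (a ⇨ x) x)
      exact le_himp_himp
  refine ⟨G, hG, fun a ha => hPG ⟨a, ha, by simp [T.box_top]⟩, fun a ha => hPG ⟨⊤, by simp, ?_⟩,
    fun a ha => ?_⟩
  · rwa [top_himp]
  · by_contra hn
    exact hd a hn ha

/-- This is (F1) for prime filters; applied to `swap` it gives (F2). -/
theorem exists_rel_of_le {F F' G : Order.PFilter H} (hF' : F'.IsPrime) (h : F ≤ F')
    (hR : T.Rel F G) : ∃ G' : Order.PFilter H, G'.IsPrime ∧ T.Rel F' G' ∧ G ≤ G' := by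
  obtain ⟨G', hG', hle, hR'⟩ := T.exists_rel hF' G fun a ha => h (hR.2 a ha)
  exact ⟨G', hG', hR', hle⟩

theorem dia_mem_iff {F : Order.PFilter H} (hF : F.IsPrime) {a : H} :
    T.dia a ∈ F ↔ ∃ G : Order.PFilter H, G.IsPrime ∧ T.Rel F G ∧ a ∈ G := by
  constructor
  · intro h
    obtain ⟨G, hG, hle, hR⟩ := T.exists_rel hF (.principal a) fun b hb =>
      Order.PFilter.mem_of_le (T.gc_dia_bbox.monotone_l hb) h
    exact ⟨G, hG, hR, hle (Order.PFilter.mem_principal.2 le_rfl)⟩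
  · rintro ⟨G, -, hR, ha⟩
    exact hR.2 a ha

/-- A prime `G` extending `boxFilter F` and omitting `a` need not be accessible from `F` itself,
only from some prime `F'` above it. That `F'` comes from the black form of `exists_rel`: if `b ∈ F`,
then `b ≤ □◆b` puts `◆b` in `G`. -/
theorem box_mem_iff {F : Order.PFilter H} {a : H} :
    T.box a ∈ F ↔ ∀ F' G : Order.PFilter H, F'.IsPrime → G.IsPrime → F ≤ F' →
      T.Rel F' G → a ∈ G := by
  constructor
  · intro h F' G _ _ hle hR
    exact hR.1 a (hle h)
  · intro h
    by_contra hn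
    obtain ⟨G, hG, hle, ha⟩ := exists_isPrime_of_notMem (P := T.boxFilter F) (b := a) hn
    obtain ⟨F', hF', hFF', hR⟩ := T.swap.exists_rel hG F fun b hb =>
      hle (Order.PFilter.mem_of_le (T.gc_bdia_box.le_u_l b) hb : T.box (T.bdia b) ∈ F)
    exact ha (h F' G hF' hG hFF' (T.rel_swap.1 hR))

/-- The frame of prime filters. -/
def primeFrame (hne : ∃ F : Order.PFilter H, F.IsPrime) : KripkeFrame.{v} where
  World := {F : Order.PFilter H // F.IsPrime}
  nonempty := nonempty_subtype.2 hne
  le F G := F.1 ≤ G.1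
  le_refl F := le_refl F.1
  le_trans _ _ _ := le_trans
  Rdia F G := T.Rel F.1 G.1
  Rbox F G := T.Rel F.1 G.1
  F1 F F' G h hR := by
    obtain ⟨G', hG', hR', hle⟩ := T.exists_rel_of_le F'.2 h hR
    exact ⟨⟨G', hG'⟩, hR', hle⟩
  F2 F G G' hR h := by
    obtain ⟨F', hF', hR', hle⟩ := T.swap.exists_rel_of_le G'.2 h (T.rel_swap.2 hR)
    exact ⟨⟨F', hF'⟩, hle, T.rel_swap.1 hR'⟩

end TenseOperators

/-! ### Derivability in the calculus -/

namespace LBiKtE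

variable {Atom : Type u} {X Y Z : Structure Atom} {A B : Formula Atom}

/-- The rules carry side contexts; this group of lemmas allows those contexts to be `empty`. -/
theorem empty_comma_left (h : LBiKtE X Y) : LBiKtE (.empty ⨟ X) Y :=
  equiv (((Structure.Equiv.comm _ _).trans (.unit X)).symm) (.refl _) h

theorem of_empty_comma_left (h : LBiKtE (.empty ⨟ X) Y) : LBiKtE X Y :=
  equiv ((Structure.Equiv.comm _ _).trans (.unit X)) (.refl _) h

theorem comma_empty_left (h : LBiKtE X Y) : LBiKtE (X ⨟ .empty) Y :=
  equiv (Structure.Equiv.unit X).symm (.refl _) h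

theorem of_comma_empty_left (h : LBiKtE (X ⨟ .empty) Y) : LBiKtE X Y :=
  equiv (.unit X) (.refl _) h

theorem empty_comma_right (h : LBiKtE X Y) : LBiKtE X (.empty ⨟ Y) :=
  equiv (.refl _) (((Structure.Equiv.comm _ _).trans (.unit Y)).symm) h

theorem of_empty_comma_right (h : LBiKtE X (.empty ⨟ Y)) : LBiKtE X Y :=
  equiv (.refl _) ((Structure.Equiv.comm _ _).trans (.unit Y)) h

theorem comma_empty_right (h : LBiKtE X Y) : LBiKtE X (Y ⨟ .empty) :=
  equiv (.refl _) (Structure.Equiv.unit Y).symm h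

theorem of_comma_empty_right (h : LBiKtE X (Y ⨟ .empty)) : LBiKtE X Y :=
  equiv (.refl _) (.unit Y) h

theorem comma_comm_left (h : LBiKtE (X ⨟ Y) Z) : LBiKtE (Y ⨟ X) Z :=
  equiv (.comm X Y) (.refl _) h

theorem weaken_right (h : LBiKtE X Y) : LBiKtE X (Y ⨟ Z) := equiv (.refl _) (.comm Z Y) (wR Z h)

theorem weaken_left (h : LBiKtE Y Z) : LBiKtE (X ⨟ Y) Z := comma_comm_left (wL X h)

theorem refl (A : Formula Atom) : LBiKtE (↟A) (↟A) :=
  of_empty_comma_left (of_comma_empty_right (id _ _ A))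

theorem trans (h₁ : LBiKtE X (↟A)) (h₂ : LBiKtE (↟A) Y) : LBiKtE X Y :=
  of_comma_empty_left (of_empty_comma_right
    (cut (empty_comma_right h₁) (comma_empty_left h₂)))

theorem trans_comma (h₁ : LBiKtE X (↟A)) (h₂ : LBiKtE (↟A ⨟ Z) Y) : LBiKtE (X ⨟ Z) Y :=
  of_empty_comma_right (cut (empty_comma_right h₁) h₂)

theorem contract_left (h : LBiKtE (X ⨟ X) Y) : LBiKtE X Y :=
  of_empty_comma_left (cL (equiv (Structure.Equiv.comma
    ((Structure.Equiv.comm _ _).trans (.unit X)).symm (.refl X)) (.refl _) h))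

theorem seqR_inv (h : LBiKtE X (Y ▷ Z)) : LBiKtE (X ⨟ Y) Z :=
  of_empty_comma_right (sR (empty_comma_right h))

theorem bot_le (X : Structure Atom) : LBiKtE (↟.bot) X := of_empty_comma_left (botL _ _)

theorem le_top (X : Structure Atom) : LBiKtE X (↟.top) := of_comma_empty_right (topR _ _)

theorem empty_iff_top : LBiKtE .empty (↟A) ↔ LBiKtE (↟.top) (↟A) :=
  ⟨fun h => of_empty_comma_left (wL _ h), fun h => trans (le_top _) h⟩

theorem and_left : LBiKtE (↟(.and A B)) (↟A) :=
  of_empty_comma_left (andL₁ B (empty_comma_left (refl A)))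

theorem and_right : LBiKtE (↟(.and A B)) (↟B) :=
  of_empty_comma_left (andL₂ A (empty_comma_left (refl B)))

theorem le_and (h₁ : LBiKtE X (↟A)) (h₂ : LBiKtE X (↟B)) : LBiKtE X (↟(.and A B)) :=
  of_comma_empty_right (andR (comma_empty_right h₁) (comma_empty_right h₂))

theorem left_or : LBiKtE (↟A) (↟(.or A B)) :=
  of_comma_empty_right (orR₁ B (comma_empty_right (refl A)))

theorem right_or : LBiKtE (↟B) (↟(.or A B)) :=
  of_comma_empty_right (orR₂ A (comma_empty_right (refl B)))

theorem or_le (h₁ : LBiKtE (↟A) Y) (h₂ : LBiKtE (↟B) Y) : LBiKtE (↟(.or A B)) Y :=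
  of_empty_comma_left (orL (empty_comma_left h₁) (empty_comma_left h₂))

/-- `andL₁` and `andL₂` each introduce the conjunction once, so contraction is needed to merge the
two copies. -/
theorem comma_iff_and : LBiKtE (↟A ⨟ ↟B) Y ↔ LBiKtE (↟(.and A B)) Y :=
  ⟨fun h => contract_left (andL₂ A (comma_comm_left (andL₁ B (comma_comm_left h)))),
    fun h => trans (le_and (wL _ (refl A)) (weaken_left (refl B))) h⟩

theorem imp_comma : LBiKtE (↟(.imp A B) ⨟ ↟A) (↟B) :=
  comma_comm_left (impL (weaken_right (refl A)) (weaken_left (refl B)))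

theorem le_imp_iff : LBiKtE X (↟(.imp A B)) ↔ LBiKtE (X ⨟ ↟A) (↟B) :=
  ⟨fun h => trans_comma h imp_comma, fun h => of_comma_empty_right (impR _ h)⟩

/-- The diamond rules exchange `◇A` with `∘A`, the black box rules exchange `■B` with `•B`, and
residuation links the two structures. -/
theorem dia_le_iff : LBiKtE (↟(.dia A)) (↟B) ↔ LBiKtE (↟A) (↟(.bbox B)) :=
  ⟨fun h => bboxR (rpBlack (trans (diaR (refl A)) h)),
    fun h => diaL (rpBlackInv (trans h (bboxL (refl B))))⟩

theorem bdia_le_iff : LBiKtE (↟(.bdia A)) (↟B) ↔ LBiKtE (↟A) (↟(.box B)) :=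
  ⟨fun h => boxR (rpWhite (trans (bdiaR (refl A)) h)),
    fun h => bdiaL (rpWhiteInv (trans h (boxL (refl B))))⟩

theorem bdia_imp_bbox_le (A B : Formula Atom) :
    LBiKtE (↟(.imp (.bdia A) (.bbox B))) (↟(.bbox (.imp A B))) := by
  -- Residuation brings `A → B` out from under `•`, where it is unfolded into the structure `A ▷ B`;
  -- it is then put back, which is the shape `blackSeqR` requires.
  refine bboxR (rpBlack (le_imp_iff.2 (seqR_inv (rpBlackInv (blackSeqR (seqR ?_))))))
  exact comma_comm_left (impL (weaken_right (bdiaR (refl A))) (weaken_left (bboxL (refl B))))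

theorem dia_imp_box_le (A B : Formula Atom) :
    LBiKtE (↟(.imp (.dia A) (.box B))) (↟(.box (.imp A B))) := by
  refine boxR (rpWhite (le_imp_iff.2 (seqR_inv (rpWhiteInv (whiteSeqR (seqR ?_))))))
  exact comma_comm_left (impL (weaken_right (diaR (refl A))) (weaken_left (boxL (refl B))))

end LBiKtE

/-! ### The Lindenbaum algebra -/

section Lindenbaum

variable {Atom : Type u}

open LBiKtE

instance : Preorder (Formula Atom) where
  le A B := LBiKtE (↟A) (↟B)
  le_refl := LBiKtE.refl
  le_trans _ _ _ := LBiKtE.trans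

/-- Formulae modulo interderivability. -/
abbrev Lindenbaum (Atom : Type u) : Type u := Antisymmetrization (Formula Atom) (· ≤ ·)

/-- The class of a formula in the Lindenbaum algebra. -/
abbrev Lindenbaum.mk (A : Formula Atom) : Lindenbaum Atom := toAntisymmetrization (· ≤ ·) A

namespace Lindenbaum

/-- A monotone operation on formulae, acting on the Lindenbaum algebra. -/
def map (f : Formula Atom → Formula Atom) (hf : Monotone f) : Lindenbaum Atom → Lindenbaum Atom :=
  Quotient.map f fun _ _ h => ⟨hf h.1, hf h.2⟩

theorem imp_mono {A A' B B' : Formula Atom} (hA : A' ≤ A) (hB : B ≤ B') :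
    Formula.imp A B ≤ Formula.imp A' B' :=
  le_imp_iff.2 (LBiKtE.trans (comma_comm_left (trans_comma hA
    (comma_comm_left imp_comma))) hB)

theorem and_mono {A A' B B' : Formula Atom} (hA : A ≤ A') (hB : B ≤ B') :
    Formula.and A B ≤ Formula.and A' B' :=
  LBiKtE.le_and (LBiKtE.trans and_left hA) (LBiKtE.trans and_right hB)

theorem or_mono {A A' B B' : Formula Atom} (hA : A ≤ A') (hB : B ≤ B') :
    Formula.or A B ≤ Formula.or A' B' :=
  LBiKtE.or_le (LBiKtE.trans hA left_or) (LBiKtE.trans hB right_or)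

theorem gc_dia_bbox : GaloisConnection (Formula.dia (Atom := Atom)) Formula.bbox :=
  fun _ _ => dia_le_iff

theorem gc_bdia_box : GaloisConnection (Formula.bdia (Atom := Atom)) Formula.box :=
  fun _ _ => bdia_le_iff

instance : Lattice (Lindenbaum Atom) where
  inf := Quotient.map₂ .and fun _ _ h _ _ k => ⟨and_mono h.1 k.1, and_mono h.2 k.2⟩
  sup := Quotient.map₂ .or fun _ _ h _ _ k => ⟨or_mono h.1 k.1, or_mono h.2 k.2⟩
  inf_le_left := by rintro ⟨A⟩ ⟨B⟩; exact and_left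
  inf_le_right := by rintro ⟨A⟩ ⟨B⟩; exact and_right
  le_inf := by rintro ⟨A⟩ ⟨B⟩ ⟨C⟩ h k; exact LBiKtE.le_and h k
  le_sup_left := by rintro ⟨A⟩ ⟨B⟩; exact left_or
  le_sup_right := by rintro ⟨A⟩ ⟨B⟩; exact right_or
  sup_le := by rintro ⟨A⟩ ⟨B⟩ ⟨C⟩ h k; exact LBiKtE.or_le h k

/-- Implication on the Lindenbaum algebra. -/
def himp : Lindenbaum Atom → Lindenbaum Atom → Lindenbaum Atom :=
  Quotient.map₂ .imp fun _ _ h _ _ k => ⟨imp_mono h.2 k.1, imp_mono h.1 k.2⟩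

instance : HeytingAlgebra (Lindenbaum Atom) where
  top := mk .top
  le_top := by rintro ⟨A⟩; exact LBiKtE.le_top _
  bot := mk .bot
  bot_le := by rintro ⟨A⟩; exact LBiKtE.bot_le _
  himp := himp
  le_himp_iff := by rintro ⟨A⟩ ⟨B⟩ ⟨C⟩; exact le_imp_iff.trans comma_iff_and
  compl a := himp a (mk .bot)
  himp_bot _ := rfl

/-- The tense operators on the Lindenbaum algebra. -/
def tense (Atom : Type u) : TenseOperators (Lindenbaum Atom) where
  box := map .box gc_bdia_box.monotone_u
  dia := map .dia gc_dia_bbox.monotone_l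
  bbox := map .bbox gc_dia_bbox.monotone_u
  bdia := map .bdia gc_bdia_box.monotone_l
  gc_dia_bbox := by rintro ⟨A⟩ ⟨B⟩; exact dia_le_iff
  gc_bdia_box := by rintro ⟨A⟩ ⟨B⟩; exact bdia_le_iff
  bdia_himp_bbox_le := by rintro ⟨A⟩ ⟨B⟩; exact bdia_imp_bbox_le A B
  dia_himp_box_le := by rintro ⟨A⟩ ⟨B⟩; exact dia_imp_box_le A B

/-- The canonical model: prime filters of the Lindenbaum algebra. -/
def canonicalModel (hne : ∃ F : Order.PFilter (Lindenbaum Atom), F.IsPrime) :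
    KripkeModel Atom where
  toKripkeFrame := (tense Atom).primeFrame hne
  val p := {F | mk (.atom p) ∈ F.1}
  persistent _ _ _ h hw := h hw

/-- The truth lemma: each connective reduces to the membership criterion for its algebraic
operation, the black modalities using the criteria of `swap` together with `rel_swap`. -/
theorem sat_canonicalModel_iff (hne : ∃ F : Order.PFilter (Lindenbaum Atom), F.IsPrime)
    (A : Formula Atom) (hA : IsIKtFormula A) :
    ∀ F : (canonicalModel hne).World, (canonicalModel hne).Sat F A ↔ mk A ∈ F.1 := by
  induction A with
  | atom p => exact fun F => Iff.rfl
  | top => exact fun F => iff_of_true trivial Order.PFilter.top_mem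
  | bot => exact fun F => iff_of_false _root_.id (bot_notMem_of_isPrime F.2)
  | imp A B ihA ihB =>
    intro F
    refine Iff.trans ?_ (himp_mem_iff (a := mk A) (b := mk B)).symm
    exact ⟨fun h G hG hle ha => (ihB hA.2 ⟨G, hG⟩).1 (h ⟨G, hG⟩ hle ((ihA hA.1 ⟨G, hG⟩).2 ha)),
      fun h G hle ha => (ihB hA.2 G).2 (h G.1 G.2 hle ((ihA hA.1 G).1 ha))⟩
  | excl => exact hA.elim
  | and A B ihA ihB =>
    intro F
    refine Iff.trans ?_ (Order.PFilter.inf_mem_iff (x := mk A) (y := mk B)).symm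
    exact and_congr (ihA hA.1 F) (ihB hA.2 F)
  | or A B ihA ihB =>
    intro F
    refine Iff.trans ?_ (sup_mem_iff_of_isPrime F.2 (a := mk A) (b := mk B)).symm
    exact or_congr (ihA hA.1 F) (ihB hA.2 F)
  | box A ih =>
    intro F
    refine Iff.trans ?_ ((tense Atom).box_mem_iff (a := mk A)).symm
    exact ⟨fun h F' G hF' hG hle hR => (ih hA ⟨G, hG⟩).1 (h ⟨F', hF'⟩ ⟨G, hG⟩ hle hR),
      fun h F' G hle hR => (ih hA G).2 (h F'.1 G.1 F'.2 G.2 hle hR)⟩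
  | dia A ih =>
    intro F
    refine Iff.trans ?_ ((tense Atom).dia_mem_iff F.2 (a := mk A)).symm
    exact ⟨fun ⟨G, hR, h⟩ => ⟨G.1, G.2, hR, (ih hA G).1 h⟩,
      fun ⟨G, hG, hR, h⟩ => ⟨⟨G, hG⟩, hR, (ih hA ⟨G, hG⟩).2 h⟩⟩
  | bbox A ih =>
    intro F
    refine Iff.trans ?_ ((tense Atom).swap.box_mem_iff (a := mk A)).symm
    exact ⟨fun h F' G hF' hG hle hR => (ih hA ⟨G, hG⟩).1
        (h ⟨F', hF'⟩ ⟨G, hG⟩ hle ((tense Atom).rel_swap.1 hR)),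
      fun h F' G hle hR => (ih hA G).2
        (h F'.1 G.1 F'.2 G.2 hle ((tense Atom).rel_swap.2 hR))⟩
  | bdia A ih =>
    intro F
    refine Iff.trans ?_ ((tense Atom).swap.dia_mem_iff F.2 (a := mk A)).symm
    exact ⟨fun ⟨G, hR, h⟩ => ⟨G.1, G.2, (tense Atom).rel_swap.2 hR, (ih hA G).1 h⟩,
      fun ⟨G, hG, hR, h⟩ => ⟨⟨G, hG⟩, (tense Atom).rel_swap.1 hR, (ih hA ⟨G, hG⟩).2 h⟩⟩

end Lindenbaum

end Lindenbaum

/-! ### Soundness and completeness -/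

variable {Atom : Type u}

theorem LBiKtE.eValid {A : Formula Atom} (h : LBiKtE .empty (↟A)) : EValid A :=
  fun M hM w => h.sound M hM w trivial

theorem EValid.derivable {A : Formula Atom} (hA : IsIKtFormula A) (h : EValid A) :
    LBiKtE .empty (↟A) := by
  rw [LBiKtE.empty_iff_top]
  by_contra hn
  -- Underivability of `A` says that its class is not above `⊤`. The prime filter `F` omitting it
  -- serves both as the refuting world and as the proof that the canonical frame is nonempty.
  obtain ⟨F, hF, -, hAF⟩ := exists_isPrime_of_notMem
    (P := Order.PFilter.principal (⊤ : Lindenbaum Atom)) (b := Lindenbaum.mk A) hn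
  have hM : (Lindenbaum.canonicalModel ⟨F, hF⟩).IsEFrame := rfl
  exact hAF ((Lindenbaum.sat_canonicalModel_iff ⟨F, hF⟩ A hA ⟨F, hF⟩).1 (h _ hM _))

/-! ### Birelational models as E-models -/

theorem IKFormula.isIKtFormula_toFormula (A : IKFormula Atom) : IsIKtFormula A.toFormula := by
  induction A <;> simp_all [IKFormula.toFormula, IsIKtFormula]

/-- A birelational model as a Kripke model over an E-frame. -/
def IKModel.toKripkeModel (M : IKModel Atom) : KripkeModel Atom where
  World := M.World
  nonempty := M.nonempty
  le := M.le
  le_refl := M.le_refl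
  le_trans := M.le_trans
  Rdia := M.R
  Rbox := M.R
  F1 := M.F1
  F2 := M.F2
  val := M.val
  persistent := M.persistent

theorem IKModel.sat_toKripkeModel_iff (M : IKModel Atom) (A : IKFormula Atom) :
    ∀ w : M.World, M.toKripkeModel.Sat w A.toFormula ↔ M.Sat w A := by
  induction A with
  | atom | top | bot => exact fun w => Iff.rfl
  | imp A B ihA ihB =>
    exact fun w => forall_congr' fun v => imp_congr_right fun _ => imp_congr (ihA v) (ihB v)
  | and A B ihA ihB => exact fun w => and_congr (ihA w) (ihB w)
  | or A B ihA ihB => exact fun w => or_congr (ihA w) (ihB w)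
  | box A ih =>
    exact fun w => forall₂_congr fun z v => imp_congr_right fun _ => imp_congr_right fun _ => ih v
  | dia A ih => exact fun w => exists_congr fun v => and_congr_right fun _ => ih v

/-- A Kripke model over an E-frame as a birelational model. -/
def KripkeModel.toIKModel (M : KripkeModel Atom) (hM : M.IsEFrame) : IKModel Atom where
  World := M.World
  nonempty := M.nonempty
  le := M.le
  le_refl := M.le_refl
  le_trans := M.le_trans
  R := M.Rdia
  F1 := M.F1
  F2 := (show M.Rbox = M.Rdia from hM) ▸ M.F2
  val := M.val
  persistent := M.persistent

theorem KripkeModel.sat_toIKModel_iff (M : KripkeModel Atom) (hM : M.IsEFrame)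
    (A : IKFormula Atom) :
    ∀ w : M.World, (M.toIKModel hM).Sat w A ↔ M.Sat w A.toFormula := by
  have hR : M.Rbox = M.Rdia := hM
  induction A with
  | atom | top | bot => exact fun w => Iff.rfl
  | imp A B ihA ihB =>
    exact fun w => forall_congr' fun v => imp_congr_right fun _ => imp_congr (ihA v) (ihB v)
  | and A B ihA ihB => exact fun w => and_congr (ihA w) (ihB w)
  | or A B ihA ihB => exact fun w => or_congr (ihA w) (ihB w)
  | box A ih =>
    exact fun w => forall₂_congr fun z v => imp_congr_right fun _ =>
      imp_congr (iff_of_eq (congrFun₂ hR z v).symm) (ih v)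
  | dia A ih => exact fun w => exists_congr fun v => and_congr_right fun _ => ih v

theorem ikValid_iff_eValid (A : IKFormula Atom) : IKValid A ↔ EValid A.toFormula :=
  ⟨fun h M hM w => (M.sat_toIKModel_iff hM A w).1 (h (M.toIKModel hM) w),
    fun h M w => (M.sat_toKripkeModel_iff A w).1 (h M.toKripkeModel rfl w)⟩

end BiKt

theorem mainTheorem5 {Atom : Type*} :
    (∀ A : BiKt.Formula Atom, BiKt.IsIKtFormula A →
      (BiKt.IKtValid A ↔ BiKt.LBiKtE BiKt.Structure.empty (BiKt.Structure.form A))) ∧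
    (∀ A : BiKt.IKFormula Atom,
      BiKt.IKValid A ↔
        BiKt.LBiKtE BiKt.Structure.empty (BiKt.Structure.form A.toFormula)) := by
  refine ⟨fun A hA => ⟨fun h => BiKt.EValid.derivable hA h, BiKt.LBiKtE.eValid⟩, fun A => ?_⟩
  rw [BiKt.ikValid_iff_eValid]
  exact ⟨BiKt.EValid.derivable A.isIKtFormula_toFormula, BiKt.LBiKtE.eValid⟩
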